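/- Let $(\Omega,\mathcal F,\mathbb P)$ be a probability space and let $(\mathcal F_n)_{n\ge 0}$ be a nondecreasing sequence of sub-$\sigma$-algebras of $\mathcal F$ such that $\mathcal F=\sigma(\bigcup_n\mathcal F_n)$ up to $\mathbb P$-null sets; write $\mathbb E_n$ for the conditional expectation given $\mathcal F_n$. Assume that $(\mathcal F_n)$ is regular: there is a constant $R>0$ such that $f_{n+1}\le R f_{n}$ a.e. for all $n\ge 0$ and all nonnegative martingales $(f_n)_{n\ge0}$. All functions take values in $\mathbb K\in\{\mathbb R,\mathbb C\}$. For $0<p,q<\infty$ put $\|h\|_{p,q}=\big(q\int_0^\infty (t\,\mathbb P(|h|>t)^{1/p})^q\,\frac{dt}{t}\big)^{1/q}$, and let $D_{p,q}$ be the space of martingales $f=(f_n)_{n\ge 0}$ with $f_0=0$ a.e. and $$\|f\|_{D_{p,q}}=\inf_\lambda\|\lambda_\infty\|_{p,q}<\infty ,$$ the infimum being over all nondecreasing, nonnegative, adapted sequences $(\lambda_n)_{n\ge0}$ with $|f_n|\le\lambda_{n-1}$ a.e. for $n\ge1$ and with $\lambda_\infty=\lim_n\lambda_n$ satisfying $\|\lambda_\infty\|_{p,q}<\infty$.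 Let $D_{p,q}^*$ be the space of linear functionals $\varphi$ on $D_{p,q}$ for which there is a finite $C$ with $|\varphi(f)|\le C\|f\|_{D_{p,q}}$ for all $f\in D_{p,q}$. An integrable function $f$ with $\mathbb E_0f=0$ is identified with the martingale $(\mathbb E_nf)_{n\ge0}$. Let $(D_{p,q}^*)_1$ be the set of those $\varphi\in D_{p,q}^*$ for which there is $g\in L_1$ such that $\varphi(f)=\mathbb E(fg)$ for all $f\in L_\infty$ with $\mathbb E_0 f=0$. If $0<p\le1$ and $0<q<\infty$, then $(D_{p,q}^*)_1=D_{p,q}^*$. In fact, for every $\varphi\in D_{p,q}^*$ there is $g\in L_2$ such that every $f\in L_2$ with $\mathbb E_0f=0$ belongs to $D_{p,q}$ and satisfies $\varphi(f)=\mathbb E(fg)$. -/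

import Mathlib

open MeasureTheory ProbabilityTheory Set Filter
open scoped ENNReal NNReal

namespace MartingaleLorentz

noncomputable section

/-! ### Lorentz quasi-norm

For a nonnegative function `f` (the modulus of the function of interest) and `0 < p, q < ∞`,
`‖f‖_{p,q} = (q ∫_0^∞ (t P(f > t)^{1/p})^q dt / t)^{1/q}`, as an extended nonnegative real. -/

/-- The integral `∫_0^∞ (t P(f > t)^{1/p})^q dt / t`. -/
def lorentzIntegral {Ω : Type*} [MeasurableSpace Ω] (P : Measure Ω) (p q : ℝ)
    (f : Ω → ℝ≥0∞) : ℝ≥0∞ :=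
  ∫⁻ t in Ioi (0 : ℝ),
    (ENNReal.ofReal t * P {ω | ENNReal.ofReal t < f ω} ^ (1 / p)) ^ q / ENNReal.ofReal t

/-- The Lorentz quasi-norm `‖f‖_{p,q}`, for `0 < p, q < ∞`. -/
def lorentzNorm {Ω : Type*} [MeasurableSpace Ω] (P : Measure Ω) (p q : ℝ)
    (f : Ω → ℝ≥0∞) : ℝ≥0∞ :=
  (ENNReal.ofReal q * lorentzIntegral P p q f) ^ (1 / q)

section LorentzFacts

variable {Ω : Type*} [MeasurableSpace Ω] {P : Measure Ω} {p q : ℝ}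

theorem lorentzNorm_lt_top_iff (hq : 0 < q) (f : Ω → ℝ≥0∞) :
    lorentzNorm P p q f < ∞ ↔ lorentzIntegral P p q f < ∞ := by
  unfold lorentzNorm
  rw [ENNReal.rpow_lt_top_iff_of_pos (by positivity), ENNReal.mul_lt_top_iff]
  have h1 : ENNReal.ofReal q ≠ 0 := by simpa using hq
  constructor
  · rintro (h | h | h)
    · exact h.2
    · exact absurd h h1
    · simp [h]
  · intro h
    exact Or.inl ⟨ENNReal.ofReal_lt_top, h⟩

theorem lorentzIntegral_mono (hp : 0 < p) (hq : 0 < q) {f g : Ω → ℝ≥0∞} (h : ∀ ω, f ω ≤ g ω) :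
    lorentzIntegral P p q f ≤ lorentzIntegral P p q g := by
  unfold lorentzIntegral
  have hp' : 0 ≤ 1 / p := by positivity
  gcongr with t ω
  exact h ω

theorem lorentzIntegral_zero (hp : 0 < p) (hq : 0 < q) :
    lorentzIntegral P p q (fun _ => 0) = 0 := by
  simp [lorentzIntegral, hq, hp]

theorem lorentz_integrand_measurable (f : Ω → ℝ≥0∞) : Measurable fun t : ℝ =>
    (ENNReal.ofReal t * P {ω | ENNReal.ofReal t < f ω} ^ (1 / p)) ^ q / ENNReal.ofReal t := by
  have h : Measurable fun t : ℝ => P {ω | ENNReal.ofReal t < f ω} := by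
    apply Antitone.measurable
    intro s t hst
    apply measure_mono
    intro ω hω
    exact lt_of_le_of_lt (ENNReal.ofReal_le_ofReal hst) hω
  exact ((ENNReal.measurable_ofReal.mul (h.pow_const _)).pow_const _).div
    ENNReal.measurable_ofReal

theorem lorentzIntegral_const_mul_lt_top (hq : 0 < q) {c : ℝ≥0} {f : Ω → ℝ≥0∞} (hc : c ≠ 0)
    (hf : lorentzIntegral P p q f < ∞) : lorentzIntegral P p q (fun ω => c * f ω) < ∞ := by
  set F : ℝ → ℝ≥0∞ := fun t =>
    (ENNReal.ofReal t * P {ω | ENNReal.ofReal t < f ω} ^ (1 / p)) ^ q / ENNReal.ofReal t with hF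
  have hc0 : 0 < (c : ℝ) := by positivity
  have hcE : (c : ℝ≥0∞) ≠ 0 := by simpa using hc
  have hci : (0 : ℝ) < (c : ℝ)⁻¹ := by positivity
  have key : lorentzIntegral P p q (fun ω => c * f ω)
      = ∫⁻ t in Ioi (0 : ℝ), ((c : ℝ≥0∞) ^ q / c) * F ((c : ℝ)⁻¹ * t) := by
    unfold lorentzIntegral
    refine setLIntegral_congr_fun measurableSet_Ioi ?_
    intro t ht
    have ht' : 0 < t := ht
    obtain ⟨u, hu, rfl⟩ : ∃ u : ℝ, 0 < u ∧ t = c * u :=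
      ⟨(c : ℝ)⁻¹ * t, by positivity, by field_simp⟩
    have hset : {ω | ENNReal.ofReal (c * u) < c * f ω} = {ω | ENNReal.ofReal u < f ω} := by
      ext ω
      rw [mem_ofPred_eq, mem_ofPred_eq, ENNReal.ofReal_mul hc0.le, ENNReal.ofReal_coe_nnreal]
      exact ENNReal.mul_lt_mul_iff_right hcE ENNReal.coe_ne_top
    have hcu : (c : ℝ)⁻¹ * (c * u) = u := by field_simp
    simp only [hF, hset, hcu]
    rw [ENNReal.ofReal_mul hc0.le, ENNReal.ofReal_coe_nnreal, mul_assoc,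
      ENNReal.mul_rpow_of_nonneg _ _ hq.le]
    simp only [div_eq_mul_inv]
    rw [ENNReal.mul_inv (Or.inl hcE) (Or.inl ENNReal.coe_ne_top)]
    ring
  have hsub : ∫⁻ t in Ioi (0 : ℝ), F ((c : ℝ)⁻¹ * t)
      = c * ∫⁻ t in Ioi (0 : ℝ), F t := by
    rw [← lintegral_indicator measurableSet_Ioi, ← lintegral_indicator measurableSet_Ioi]
    have hm : Measurable ((Ioi (0 : ℝ)).indicator F) :=
      (lorentz_integrand_measurable f).indicator measurableSet_Ioi
    have h1 : ∀ t, (Ioi (0 : ℝ)).indicator (fun t => F ((c : ℝ)⁻¹ * t)) t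
        = (Ioi (0 : ℝ)).indicator F ((c : ℝ)⁻¹ * t) := by
      intro t
      by_cases ht : 0 < t
      · rw [indicator_of_mem (show t ∈ Ioi (0 : ℝ) from ht),
          indicator_of_mem (show (c : ℝ)⁻¹ * t ∈ Ioi (0 : ℝ) from mul_pos hci ht)]
      · rw [indicator_of_notMem (show t ∉ Ioi (0 : ℝ) from ht), indicator_of_notMem]
        intro h
        exact ht ((mul_pos_iff_of_pos_left hci).1 h)
    simp_rw [h1]
    rw [← lintegral_map hm (measurable_const_mul _), Real.map_volume_mul_left hci.ne',
      lintegral_smul_measure, inv_inv, abs_of_pos hc0, ENNReal.ofReal_coe_nnreal, smul_eq_mul]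
  have hK : (c : ℝ≥0∞) ^ q / c < ∞ :=
    ENNReal.div_lt_top (ENNReal.rpow_ne_top_of_nonneg hq.le ENNReal.coe_ne_top) hcE
  rw [key, lintegral_const_mul' _ _ hK.ne, hsub]
  exact ENNReal.mul_lt_top hK (ENNReal.mul_lt_top ENNReal.coe_lt_top hf)

theorem lorentzIntegral_max_lt_top (hp : 0 < p) (hq : 0 < q) {f g : Ω → ℝ≥0∞}
    (hf : lorentzIntegral P p q f < ∞) (hg : lorentzIntegral P p q g < ∞) :
    lorentzIntegral P p q (fun ω => max (f ω) (g ω)) < ∞ := by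
  have hK : (2 : ℝ≥0∞) ^ (1 / p * q) ≠ ∞ :=
    ENNReal.rpow_ne_top_of_nonneg (by positivity) (by simp)
  have hle : lorentzIntegral P p q (fun ω => max (f ω) (g ω)) ≤
      2 ^ (1 / p * q) * (lorentzIntegral P p q f + lorentzIntegral P p q g) := by
    unfold lorentzIntegral
    rw [← lintegral_add_left (lorentz_integrand_measurable f), ← lintegral_const_mul' _ _ hK]
    apply lintegral_mono
    intro t
    have hset : {ω | ENNReal.ofReal t < max (f ω) (g ω)}
        = {ω | ENNReal.ofReal t < f ω} ∪ {ω | ENNReal.ofReal t < g ω} := by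
      ext ω; simp
    simp only [hset]
    set a := P {ω | ENNReal.ofReal t < f ω}
    set b := P {ω | ENNReal.ofReal t < g ω}
    have hscale : ∀ x : ℝ≥0∞, (ENNReal.ofReal t * (2 * x) ^ (1 / p)) ^ q / ENNReal.ofReal t
        = 2 ^ (1 / p * q) * ((ENNReal.ofReal t * x ^ (1 / p)) ^ q / ENNReal.ofReal t) := by
      intro x
      rw [ENNReal.mul_rpow_of_nonneg _ _ (by positivity : 0 ≤ 1 / p), mul_left_comm,
        ENNReal.mul_rpow_of_nonneg _ _ hq.le, ← ENNReal.rpow_mul, mul_div_assoc]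
    have hmono : ∀ x : ℝ≥0∞, a + b ≤ 2 * x →
        (ENNReal.ofReal t * P ({ω | ENNReal.ofReal t < f ω} ∪ {ω | ENNReal.ofReal t < g ω})
          ^ (1 / p)) ^ q / ENNReal.ofReal t
        ≤ 2 ^ (1 / p * q) * ((ENNReal.ofReal t * x ^ (1 / p)) ^ q / ENNReal.ofReal t) := by
      intro x hx
      rw [← hscale]
      gcongr
      exact (measure_union_le _ _).trans hx
    rcases le_total a b with h | h
    · refine (hmono b ?_).trans ?_
      · rw [two_mul]; gcongr
      · gcongr; exact le_add_self
    · refine (hmono a ?_).trans ?_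
      · rw [two_mul]; gcongr
      · gcongr; exact le_self_add
  exact hle.trans_lt (ENNReal.mul_lt_top hK.lt_top (ENNReal.add_lt_top.2 ⟨hf, hg⟩))

theorem lorentzNorm_add_lt_top (hp : 0 < p) (hq : 0 < q) {f g : Ω → ℝ≥0∞}
    (hf : lorentzNorm P p q f < ∞) (hg : lorentzNorm P p q g < ∞) :
    lorentzNorm P p q (fun ω => f ω + g ω) < ∞ := by
  rw [lorentzNorm_lt_top_iff hq] at *
  refine (lorentzIntegral_mono hp hq (g := fun ω => (2 : ℝ≥0) * max (f ω) (g ω)) ?_).trans_lt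
    (lorentzIntegral_const_mul_lt_top hq two_ne_zero (lorentzIntegral_max_lt_top hp hq hf hg))
  intro ω
  rw [ENNReal.coe_ofNat, two_mul]
  gcongr
  · exact le_max_left _ _
  · exact le_max_right _ _

theorem lorentzNorm_const_mul_lt_top (hp : 0 < p) (hq : 0 < q) (c : ℝ≥0) {f : Ω → ℝ≥0∞}
    (hf : lorentzNorm P p q f < ∞) : lorentzNorm P p q (fun ω => c * f ω) < ∞ := by
  rw [lorentzNorm_lt_top_iff hq] at *
  rcases eq_or_ne c 0 with rfl | hc
  · simp [lorentzIntegral_zero hp hq]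
  · exact lorentzIntegral_const_mul_lt_top hq hc hf

end LorentzFacts

/-! ### Stochastic bases and the space `D_{p,q}` -/

section Spaces

variable {Ω : Type*} {m0 : MeasurableSpace Ω}

/-- `ℱ` is regular: there is a constant `R > 0` such that `f_{n+1} ≤ R f_n` a.e. for all `n ≥ 0` and
all nonnegative martingales `f`. -/
def IsRegular (ℱ : Filtration ℕ m0) (P : Measure Ω) : Prop :=
  ∃ R : ℝ, 0 < R ∧ ∀ f : ℕ → Ω → ℝ, Martingale f ℱ P → (∀ n, ∀ᵐ ω ∂P, 0 ≤ f n ω) →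
    ∀ n, ∀ᵐ ω ∂P, f (n + 1) ω ≤ R * f n ω

/-- The `σ`-algebra of the ambient space is generated by `⋃ n, ℱ n`, up to `P`-null sets. -/
def Generates (ℱ : Filtration ℕ m0) (P : Measure Ω) : Prop :=
  ∀ s : Set Ω, MeasurableSet[m0] s → ∃ t : Set Ω, MeasurableSet[⨆ n, ℱ n] t ∧ s =ᵐ[P] t

variable {𝕜 : Type*} [RCLike 𝕜]

/-- `λ_∞ = lim λ_n`, for a nondecreasing sequence of nonnegative functions. -/
def limitFun (l : ℕ → Ω → ℝ≥0) (ω : Ω) : ℝ≥0∞ := ⨆ n, (l n ω : ℝ≥0∞)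

/-- The class `Λ[D_{p,q}](f)`: nondecreasing nonnegative adapted sequences `λ` such that
`|f_n| ≤ λ_{n-1}` a.e. for `n ≥ 1` and `λ_∞ ∈ L_{p,q}`. -/
def predictableMajorants (ℱ : Filtration ℕ m0) (P : Measure Ω) (p q : ℝ) (f : ℕ → Ω → 𝕜) :
    Set (ℕ → Ω → ℝ≥0) :=
  {l | (∀ n, Measurable[ℱ n] (l n)) ∧ (∀ ω, Monotone fun n => l n ω) ∧
    (∀ n, ∀ᵐ ω ∂P, ‖f (n + 1) ω‖₊ ≤ l n ω) ∧ lorentzNorm P p q (limitFun l) < ∞}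

/-- `‖f‖_{D_{p,q}}`, with value `∞` if `f` has no admissible majorant. -/
def dNorm (ℱ : Filtration ℕ m0) (P : Measure Ω) (p q : ℝ) (f : ℕ → Ω → 𝕜) : ℝ≥0∞ :=
  ⨅ l ∈ predictableMajorants ℱ P p q f, lorentzNorm P p q (limitFun l)

theorem dNorm_lt_top_iff {ℱ : Filtration ℕ m0} {P : Measure Ω} {p q : ℝ} {f : ℕ → Ω → 𝕜} :
    dNorm ℱ P p q f < ∞ ↔ (predictableMajorants ℱ P p q f).Nonempty := by
  unfold dNorm
  simp only [iInf_lt_iff]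
  constructor
  · rintro ⟨l, hl, -⟩
    exact ⟨l, hl⟩
  · rintro ⟨l, hl⟩
    exact ⟨l, hl, hl.2.2.2⟩

/-- The space `D_{p,q}` of `𝕜`-valued martingales `f` with `f_0 = 0` a.e. and
`‖f‖_{D_{p,q}} < ∞`. (Martingales are not identified when they agree almost everywhere; since
`dNorm` vanishes on a.e. zero martingales, this does not affect the bounded functionals.) -/
def D (𝕜 : Type*) [RCLike 𝕜] (ℱ : Filtration ℕ m0) (P : Measure Ω) {p q : ℝ}
    (hp : 0 < p) (hq : 0 < q) : Submodule 𝕜 (ℕ → Ω → 𝕜) where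
  carrier := {f | Martingale f ℱ P ∧ f 0 =ᵐ[P] 0 ∧ dNorm ℱ P p q f < ∞}
  zero_mem' := by
    refine ⟨martingale_zero 𝕜 ℱ P, by rfl, dNorm_lt_top_iff.2 ⟨fun _ _ => 0, ?_, ?_, ?_, ?_⟩⟩
    · intro n
      exact @measurable_const _ _ _ (ℱ n) _
    · intro ω
      exact monotone_const
    · intro n
      simp
    · rw [lorentzNorm_lt_top_iff hq]
      have : limitFun (fun (_ : ℕ) (_ : Ω) => (0 : ℝ≥0)) = fun _ => 0 := by
        ext ω; simp [limitFun]
      rw [this, lorentzIntegral_zero hp hq]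
      exact ENNReal.zero_lt_top
  add_mem' := by
    rintro f g ⟨hf, hf0, hfD⟩ ⟨hg, hg0, hgD⟩
    obtain ⟨l, hl1, hl2, hl3, hl4⟩ := dNorm_lt_top_iff.1 hfD
    obtain ⟨k, hk1, hk2, hk3, hk4⟩ := dNorm_lt_top_iff.1 hgD
    refine ⟨hf.add hg, by simpa using hf0.add hg0,
      dNorm_lt_top_iff.2 ⟨fun n ω => l n ω + k n ω, ?_, ?_, ?_, ?_⟩⟩
    · intro n
      exact (hl1 n).add (hk1 n)
    · intro ω
      exact (hl2 ω).add (hk2 ω)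
    · intro n
      filter_upwards [hl3 n, hk3 n] with ω h1 h2
      exact (nnnorm_add_le _ _).trans (add_le_add h1 h2)
    · rw [lorentzNorm_lt_top_iff hq]
      refine (lorentzIntegral_mono hp hq ?_).trans_lt
        ((lorentzNorm_lt_top_iff hq _).1 (lorentzNorm_add_lt_top hp hq hl4 hk4))
      intro ω
      refine iSup_le fun n => ?_
      rw [ENNReal.coe_add]
      exact add_le_add (le_iSup (fun n => (l n ω : ℝ≥0∞)) n) (le_iSup (fun n => (k n ω : ℝ≥0∞)) n)
  smul_mem' := by
    rintro c f ⟨hf, hf0, hfD⟩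
    obtain ⟨l, hl1, hl2, hl3, hl4⟩ := dNorm_lt_top_iff.1 hfD
    refine ⟨⟨fun n => (hf.1 n).const_smul c, fun i j hij => ?_⟩, ?_,
      dNorm_lt_top_iff.2 ⟨fun n ω => ‖c‖₊ * l n ω, ?_, ?_, ?_, ?_⟩⟩
    · exact (condExp_smul c (f j) (ℱ i)).trans ((hf.2 i j hij).fun_const_smul c)
    · filter_upwards [hf0] with ω h
      simp [h]
    · intro n
      exact (hl1 n).const_mul _
    · intro ω a b hab
      exact mul_le_mul_right (hl2 ω hab) _
    · intro n
      filter_upwards [hl3 n] with ω h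
      simp only [Pi.smul_apply, nnnorm_smul]
      gcongr
    · have := lorentzNorm_const_mul_lt_top hp hq ‖c‖₊ hl4
      convert this using 2
      ext ω
      simp [limitFun, ENNReal.mul_iSup]

/-- The dual `D_{p,q}^*`: linear functionals `φ` on `D_{p,q}` with
`|φ(f)| ≤ C ‖f‖_{D_{p,q}}` for all `f` and some finite constant `C`. -/
def dualD (𝕜 : Type*) [RCLike 𝕜] (ℱ : Filtration ℕ m0) (P : Measure Ω) {p q : ℝ}
    (hp : 0 < p) (hq : 0 < q) : Submodule 𝕜 (D 𝕜 ℱ P hp hq →ₗ[𝕜] 𝕜) where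
  carrier := {φ | ∃ C : ℝ≥0, ∀ f : D 𝕜 ℱ P hp hq, ‖φ f‖ₑ ≤ C * dNorm ℱ P p q (f : ℕ → Ω → 𝕜)}
  zero_mem' := ⟨0, fun f => by simp⟩
  add_mem' := by
    rintro φ ψ ⟨A, hA⟩ ⟨B, hB⟩
    refine ⟨A + B, fun f => ?_⟩
    rw [LinearMap.add_apply, ENNReal.coe_add, add_mul]
    exact (enorm_add_le _ _).trans (add_le_add (hA f) (hB f))
  smul_mem' := by
    rintro c φ ⟨A, hA⟩
    refine ⟨‖c‖₊ * A, fun f => ?_⟩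
    rw [LinearMap.smul_apply, enorm_smul, ENNReal.coe_mul, mul_assoc, enorm_eq_nnnorm]
    gcongr
    exact hA f

/-- The martingale `(E_n f)_{n ≥ 0}` with which an integrable function `f` is identified. -/
def condExpMartingale (ℱ : Filtration ℕ m0) (P : Measure Ω) (f : Ω → 𝕜) : ℕ → Ω → 𝕜 :=
  fun n => P[f | ℱ n]

/-- The functional `φ` is represented by `g` on the functions `f ∈ L_r` with `E_0 f = 0`: each such
`f` (identified with its martingale) belongs to `D_{p,q}`, and `φ(f) = E(f g)`.
(For `r = ∞` the membership always holds: the constant `‖f‖_∞` is a majorant.) -/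
def RepresentedOn (ℱ : Filtration ℕ m0) (P : Measure Ω) {p q : ℝ} {hp : 0 < p} {hq : 0 < q}
    (φ : D 𝕜 ℱ P hp hq →ₗ[𝕜] 𝕜) (r : ℝ≥0∞) (g : Ω → 𝕜) : Prop :=
  ∀ f : Ω → 𝕜, MemLp f r P → P[f | ℱ 0] =ᵐ[P] 0 →
    ∃ h : condExpMartingale ℱ P f ∈ D 𝕜 ℱ P hp hq,
      φ ⟨condExpMartingale ℱ P f, h⟩ = ∫ ω, f ω * g ω ∂P

/-- `(D_{p,q}^*)_1`: those `φ ∈ D_{p,q}^*` for which there is `g ∈ L_1` such that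
`φ(f) = E(f g)` for all `f ∈ L_∞` (with `E_0 f = 0`). -/
def dualDOne (𝕜 : Type*) [RCLike 𝕜] (ℱ : Filtration ℕ m0) (P : Measure Ω) {p q : ℝ}
    (hp : 0 < p) (hq : 0 < q) : Set (D 𝕜 ℱ P hp hq →ₗ[𝕜] 𝕜) :=
  {φ | φ ∈ dualD 𝕜 ℱ P hp hq ∧ ∃ g : Ω → 𝕜, MemLp g 1 P ∧ RepresentedOn ℱ P φ ∞ g}

end Spaces

end

end MartingaleLorentz

/-! The point is that `L₂` embeds boundedly into `D_{p,q}` for every `p < 2`, so a bounded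
functional restricts to `L₂` and is given there by Riesz representation. For `f ∈ L₂` put `G_n =
E_n|f|²`. Conditional Jensen and regularity give `|f_{n+1}|² ≤ G_{n+1} ≤ R G_n`, so `λ_n = √(R
max_{k≤n} G_k)` is an adapted majorant with the required shift of index. Doob's maximal inequality
gives `P(λ_∞ > t) ≤ R‖f‖₂²/t²`; since `P` has mass one, this weak `L₂` bound forces `λ_∞ ∈ L_{p,q}`,
with a bound depending only on `R`, `p`, `q` and `‖f‖₂` (`exists_dNorm_condExpMartingale_le`). The
equality of the two duals follows from `L_∞ ⊂ L₂ ⊂ L₁`. -/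

namespace MartingaleLorentz

/-! ### Weak `L₂` inside `L_{p,q}` on a probability space. -/

section WeakType

variable {p q : ℝ}

/-- The Lorentz integral of a function whose distribution function is `min 1 (C / t ^ 2)`. -/
noncomputable def weakTypeBound (p q : ℝ) (C : ℝ≥0) : ℝ≥0∞ :=
  ∫⁻ t in Ioi (0 : ℝ),
    (ENNReal.ofReal t * min 1 (C / ENNReal.ofReal t ^ 2) ^ (1 / p)) ^ q / ENNReal.ofReal t

theorem lorentzIntegral_le_weakTypeBound {Ω : Type*} [MeasurableSpace Ω] {P : Measure Ω}
    [IsProbabilityMeasure P] (hp : 0 < p) (hq : 0 < q) {C : ℝ≥0} {f : Ω → ℝ≥0∞}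
    (hf : ∀ t : ℝ, 0 < t → P {ω | ENNReal.ofReal t < f ω} ≤ C / ENNReal.ofReal t ^ 2) :
    lorentzIntegral P p q f ≤ weakTypeBound p q C := by
  have hp' : 0 ≤ 1 / p := by positivity
  refine setLIntegral_mono' measurableSet_Ioi fun t ht => ?_
  gcongr
  exact le_min prob_le_one (hf t ht)

/-- Split at `t = 1`. Below, the minimum is at most `1` and `t^(q-1)` is integrable because `q > 0`.
Above, the other entry gives `C^(q/p) t^(q(1-2/p)-1)`, integrable at infinity because `p < 2`. -/
theorem weakTypeBound_lt_top (hp : 0 < p) (hp2 : p < 2) (hq : 0 < q) (C : ℝ≥0) :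
    weakTypeBound p q C < ∞ := by
  have hp' : 0 ≤ 1 / p := by positivity
  unfold weakTypeBound
  rw [← Ioc_union_Ioi_eq_Ioi zero_le_one]
  refine (lintegral_union_le _ _ _).trans_lt (ENNReal.add_lt_top.2 ⟨?_, ?_⟩)
  · have hint : IntegrableOn (fun t : ℝ => t ^ (q - 1)) (Ioc 0 1) :=
      (intervalIntegrable_iff_integrableOn_Ioc_of_le zero_le_one).1
        (intervalIntegral.intervalIntegrable_rpow' (by linarith))
    refine (setLIntegral_mono' measurableSet_Ioc fun t ht => ?_).trans_lt hint.lintegral_lt_top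
    have ht0 : 0 < t := ht.1
    rw [← ENNReal.ofReal_rpow_of_pos ht0, ENNReal.rpow_sub _ _ (by simpa using ht0) (by simp),
      ENNReal.rpow_one]
    gcongr
    refine mul_le_of_le_one_right' (ENNReal.rpow_le_one (min_le_left _ _) hp')
  · have hlt : q * (1 - 2 / p) - 1 < -1 := by
      have : 1 < 2 / p := by rwa [lt_div_iff₀ hp, one_mul]
      nlinarith
    have hint := integrableOn_Ioi_rpow_of_lt hlt one_pos
    have hK : (C : ℝ≥0∞) ^ (1 / p * q) ≠ ∞ :=
      ENNReal.rpow_ne_top_of_nonneg (by positivity) ENNReal.coe_ne_top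
    refine (setLIntegral_mono' measurableSet_Ioi fun t ht => ?_).trans_lt
      (b := ∫⁻ t in Ioi (1 : ℝ), C ^ (1 / p * q) * ENNReal.ofReal (t ^ (q * (1 - 2 / p) - 1))) ?_
    · have ht0 : 0 < t := one_pos.trans ht
      have h0 : ENNReal.ofReal t ≠ 0 := by simpa using ht0
      have htop : ENNReal.ofReal t ≠ ∞ := by simp
      calc _ ≤ (ENNReal.ofReal t * (C / ENNReal.ofReal t ^ 2) ^ (1 / p)) ^ q /
            ENNReal.ofReal t := by
            gcongr
            exact min_le_right _ _
        _ = _ := by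
            rw [← ENNReal.ofReal_rpow_of_pos ht0, ENNReal.rpow_sub _ _ h0 htop, ENNReal.rpow_one,
              div_eq_mul_inv (C : ℝ≥0∞), ENNReal.mul_rpow_of_nonneg _ _ hp', mul_left_comm,
              ENNReal.mul_rpow_of_nonneg _ _ hq.le, ← ENNReal.rpow_mul, ← mul_div_assoc,
              ← ENNReal.rpow_natCast, ← ENNReal.rpow_neg, ← ENNReal.rpow_mul]
            conv_lhs => enter [1, 2, 1, 1]; rw [← ENNReal.rpow_one (ENNReal.ofReal t)]
            rw [← ENNReal.rpow_add _ _ h0 htop, ← ENNReal.rpow_mul]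
            congr 3
            push_cast
            ring
    · rw [lintegral_const_mul' _ _ hK]
      exact ENNReal.mul_lt_top hK.lt_top hint.lintegral_lt_top

end WeakType

/-! ### Predictable majorants from regularity and Doob's inequality. -/

section Majorant

variable {Ω : Type*} {m0 : MeasurableSpace Ω} {P : Measure Ω} {ℱ : Filtration ℕ m0}
  {𝕜 : Type*} [RCLike 𝕜]

theorem sq_norm_condExp_le {f : Ω → 𝕜} (hf : MemLp f 2 P) (m : MeasurableSpace Ω) :
    ∀ᵐ ω ∂P, ‖(P[f | m]) ω‖ ^ 2 ≤ (P[fun ω => ‖f ω‖ ^ 2 | m]) ω := by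
  have h := Integrable.norm_condExp_rpow_le (m := m) (f := f) (μ := P) one_le_two
    (by simpa using hf.integrable_norm_pow two_ne_zero)
  simp only [Real.rpow_ofNat] at h
  exact h

/-- The running maximum `max_{k ≤ n} (G_k)⁺`. -/
noncomputable def runningMax (G : ℕ → Ω → ℝ) (n : ℕ) (ω : Ω) : ℝ :=
  (Finset.range (n + 1)).sup' Finset.nonempty_range_add_one fun k => (G⁺) k ω

theorem runningMax_mono (G : ℕ → Ω → ℝ) (ω : Ω) : Monotone fun n => runningMax G n ω := by
  intro a b hab
  exact Finset.sup'_mono _ (by simpa using hab) _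

theorem le_runningMax (G : ℕ → Ω → ℝ) (n : ℕ) (ω : Ω) : G n ω ≤ runningMax G n ω :=
  (le_posPart (G n ω)).trans
    (Finset.le_sup' (fun k => (G⁺) k ω) (Finset.self_mem_range_succ n))

theorem measurable_runningMax {G : ℕ → Ω → ℝ} (hG : ∀ n, StronglyMeasurable[ℱ n] (G n)) (n : ℕ) :
    Measurable[ℱ n] (runningMax G n) := by
  have h : runningMax G n =
      (Finset.range (n + 1)).sup' Finset.nonempty_range_add_one fun k => (G⁺) k := by
    ext ω
    simp [runningMax, Finset.sup'_apply]
  rw [h]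
  refine Finset.sup'_induction _ _ (p := fun f => Measurable[ℱ n] f)
    (fun f hf g hg => hf.sup hg) fun k hk => ?_
  have hk' : Measurable[ℱ n] (G k) :=
    ((hG k).mono (ℱ.mono (Finset.mem_range_succ_iff.1 hk))).measurable
  exact Measurable.sup_const hk' 0

theorem measure_le_runningMax [IsFiniteMeasure P] {G : ℕ → Ω → ℝ} (hG : Martingale G ℱ P)
    (hG0 : ∀ n, 0 ≤ᵐ[P] G n) {ε : ℝ≥0} (hε : ε ≠ 0) (n : ℕ) :
    P {ω | (ε : ℝ) ≤ runningMax G n ω} ≤ ENNReal.ofReal (∫ ω, G 0 ω ∂P) / ε := by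
  -- Doob's inequality is applied to a pointwise nonnegative process, whereas `G` is nonnegative
  -- only a.e.; positive parts repair this without changing the integrals.
  have hsub := hG.submartingale.pos
  have h := maximal_ineq hsub (fun n ω => posPart_nonneg (G n ω)) (ε := ε) n
  rw [ENNReal.le_div_iff_mul_le (by simp [hε]) (by simp), mul_comm]
  refine h.trans (ENNReal.ofReal_le_ofReal ?_)
  refine (setIntegral_le_integral (hsub.integrable n) (ae_of_all _ fun ω => ?_)).trans_eq ?_
  · exact posPart_nonneg (G n ω)
  · have h1 : ∫ ω, (G⁺) n ω ∂P = ∫ ω, G n ω ∂P := integral_congr_ae <| by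
      filter_upwards [hG0 n] with ω hω
      exact posPart_of_nonneg hω
    have h2 := hG.setIntegral_eq (Nat.zero_le n) (MeasurableSet.univ)
    rw [h1]
    simpa using h2.symm

/-- The predictable majorant `√(R max_{k ≤ n} (G_k)⁺)`. -/
noncomputable def sqrtMajorant (R : ℝ) (G : ℕ → Ω → ℝ) (n : ℕ) (ω : Ω) : ℝ≥0 :=
  (√(R * runningMax G n ω)).toNNReal

theorem sqrtMajorant_mono {R : ℝ} (hR : 0 < R) (G : ℕ → Ω → ℝ) (ω : Ω) :
    Monotone fun n => sqrtMajorant R G n ω := by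
  intro a b hab
  exact Real.toNNReal_mono (Real.sqrt_le_sqrt
    (mul_le_mul_of_nonneg_left (runningMax_mono G ω hab) hR.le))

theorem measure_lt_limitFun_sqrtMajorant_le [IsFiniteMeasure P] {G : ℕ → Ω → ℝ}
    (hG : Martingale G ℱ P) (hG0 : ∀ n, 0 ≤ᵐ[P] G n) {R : ℝ} (hR : 0 < R) {A : ℝ≥0}
    (hA : ∫ ω, G 0 ω ∂P ≤ A) {t : ℝ} (ht : 0 < t) :
    P {ω | ENNReal.ofReal t < limitFun (sqrtMajorant R G) ω} ≤
      (R.toNNReal * A : ℝ≥0) / ENNReal.ofReal t ^ 2 := by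
  have hunion : {ω | ENNReal.ofReal t < limitFun (sqrtMajorant R G) ω} =
      ⋃ n, {ω | ENNReal.ofReal t < sqrtMajorant R G n ω} := by
    ext ω
    simp [limitFun, lt_iSup_iff]
  rw [hunion, Monotone.measure_iUnion]
  swap
  · intro a b hab ω hω
    exact lt_of_lt_of_le (show ENNReal.ofReal t < sqrtMajorant R G a ω from hω)
      (ENNReal.coe_le_coe.2 (sqrtMajorant_mono hR G ω hab))
  refine iSup_le fun n => ?_
  -- This is the level at which `√(R M) > t` becomes `M > t²/R`.
  set ε : ℝ≥0 := (t ^ 2 / R).toNNReal with hε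
  have hεpos : 0 < t ^ 2 / R := by positivity
  have hε0 : ε ≠ 0 := (Real.toNNReal_pos.2 hεpos).ne'
  have hsub : {ω | ENNReal.ofReal t < sqrtMajorant R G n ω} ⊆
      {ω | (ε : ℝ) ≤ runningMax G n ω} := by
    intro ω hω
    have h1 : t < √(R * runningMax G n ω) :=
      (ENNReal.ofReal_lt_ofReal_iff_of_nonneg ht.le).1 hω
    have h2 := (Real.lt_sqrt ht.le).1 h1
    show (ε : ℝ) ≤ runningMax G n ω
    rw [hε, Real.coe_toNNReal _ hεpos.le, div_le_iff₀ hR, mul_comm]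
    exact h2.le
  refine (measure_mono hsub).trans ((measure_le_runningMax hG hG0 hε0 n).trans ?_)
  calc ENNReal.ofReal (∫ ω, G 0 ω ∂P) / ε ≤ ENNReal.ofReal A / ε := by gcongr
    _ = _ := by
      change _ / ENNReal.ofReal (t ^ 2 / R) = _
      have hA0 : (0 : ℝ) ≤ A := A.2
      rw [← ENNReal.ofReal_div_of_pos hεpos, ← ENNReal.ofReal_pow ht.le,
        ← ENNReal.ofReal_coe_nnreal, ← ENNReal.ofReal_div_of_pos (by positivity)]
      congr 1
      rw [NNReal.coe_mul, Real.coe_toNNReal _ hR.le]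
      field_simp

/-- On a regular stochastic basis the ball of radius `√A` of `L₂` is bounded in `D_{p,q}`. -/
theorem exists_dNorm_condExpMartingale_le [IsProbabilityMeasure P] (hreg : IsRegular ℱ P) {p q : ℝ}
    (hp : 0 < p) (hp2 : p < 2) (hq : 0 < q) (A : ℝ≥0) :
    ∃ K : ℝ≥0, ∀ f : Ω → 𝕜, MemLp f 2 P → ∫ ω, ‖f ω‖ ^ 2 ∂P ≤ A →
      dNorm ℱ P p q (condExpMartingale ℱ P f) ≤ K := by
  obtain ⟨R, hR, hreg⟩ := hreg
  have hfin : (ENNReal.ofReal q * weakTypeBound p q (R.toNNReal * A)) ^ (1 / q) < ∞ :=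
    ENNReal.rpow_lt_top_of_nonneg (by positivity)
      (ENNReal.mul_lt_top ENNReal.ofReal_lt_top (weakTypeBound_lt_top hp hp2 hq _)).ne
  lift (ENNReal.ofReal q * weakTypeBound p q (R.toNNReal * A)) ^ (1 / q) to ℝ≥0
    using hfin.ne with K hK
  refine ⟨K, fun f hf hfA => ?_⟩
  set G : ℕ → Ω → ℝ := fun n => P[fun ω => ‖f ω‖ ^ 2 | ℱ n] with hGdef
  have hG : Martingale G ℱ P := martingale_condExp _ _ _
  have hG0 : ∀ n, 0 ≤ᵐ[P] G n := fun n => condExp_nonneg (ae_of_all _ fun ω => by positivity)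
  have hGA : ∫ ω, G 0 ω ∂P ≤ A := by rwa [hGdef, integral_condExp]
  have hnorm : lorentzNorm P p q (limitFun (sqrtMajorant R G)) ≤ K := by
    rw [hK]
    unfold lorentzNorm
    gcongr
    exact lorentzIntegral_le_weakTypeBound hp hq fun t ht =>
      measure_lt_limitFun_sqrtMajorant_le hG hG0 hR hGA ht
  have hmem : sqrtMajorant R G ∈ predictableMajorants ℱ P p q (condExpMartingale ℱ P f) := by
    refine ⟨fun n => ?_, sqrtMajorant_mono hR G, fun n => ?_, hnorm.trans_lt ENNReal.coe_lt_top⟩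
    · exact ((measurable_runningMax hG.stronglyAdapted n).const_mul R).sqrt.real_toNNReal
    -- Jensen is used at time `n + 1`; regularity then trades `G (n + 1)` for `R * G n`, which is `ℱ
    -- n`-measurable.
    · filter_upwards [sq_norm_condExp_le hf (ℱ (n + 1)),
        hreg G hG (fun n => hG0 n) n] with ω h1 h2
      have h3 : ‖(P[f | ℱ (n + 1)]) ω‖ ≤ √(R * runningMax G n ω) :=
        Real.le_sqrt_of_sq_le (h1.trans (h2.trans
          (mul_le_mul_of_nonneg_left (le_runningMax G n ω) hR.le)))
      exact (Real.le_toNNReal_iff_coe_le (Real.sqrt_nonneg _)).2 h3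
  exact (iInf₂_le _ hmem).trans hnorm

end Majorant

/-! ### Restriction to `L₂` and Riesz representation. -/

section Representation

variable {Ω : Type*} {m0 : MeasurableSpace Ω} {P : Measure Ω} {ℱ : Filtration ℕ m0}
  {𝕜 : Type*} [RCLike 𝕜] {p q : ℝ}

theorem dNorm_congr_ae {f g : ℕ → Ω → 𝕜} (h : ∀ n, f n =ᵐ[P] g n) :
    dNorm ℱ P p q f = dNorm ℱ P p q g := by
  have hset : predictableMajorants ℱ P p q f = predictableMajorants ℱ P p q g := by
    ext l
    refine and_congr_right fun _ => and_congr_right fun _ => and_congr_left fun _ =>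
      forall_congr' fun n => eventually_congr ?_
    filter_upwards [h (n + 1)] with ω hω
    rw [hω]
  simp only [dNorm, hset]

theorem dNorm_zero (hp : 0 < p) (hq : 0 < q) : dNorm ℱ P p q (0 : ℕ → Ω → 𝕜) = 0 := by
  have hlim : limitFun (fun (_ : ℕ) (_ : Ω) => (0 : ℝ≥0)) = fun _ => 0 := by
    ext ω; simp [limitFun]
  have hz : lorentzNorm P p q (limitFun (fun (_ : ℕ) (_ : Ω) => (0 : ℝ≥0))) = 0 := by
    rw [hlim, lorentzNorm, lorentzIntegral_zero hp hq, mul_zero,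
      ENNReal.zero_rpow_of_pos (by positivity)]
  refine le_antisymm ((iInf₂_le (fun _ _ => 0) ⟨fun n => ?_, fun ω => monotone_const,
    fun n => by simp, by simp [hz]⟩).trans_eq hz) zero_le
  exact @measurable_const _ _ _ (ℱ n) _

/-- The difference has zero quasi-norm, so boundedness kills it. This is what makes `f ↦ φ((E_n
f)_n)` linear, conditional expectation being linear only a.e. -/
theorem apply_eq_of_ae_eq {hp : 0 < p} {hq : 0 < q} {φ : D 𝕜 ℱ P hp hq →ₗ[𝕜] 𝕜}
    (hφ : φ ∈ dualD 𝕜 ℱ P hp hq) {f g : D 𝕜 ℱ P hp hq}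
    (h : ∀ n, (f : ℕ → Ω → 𝕜) n =ᵐ[P] (g : ℕ → Ω → 𝕜) n) : φ f = φ g := by
  obtain ⟨C, hC⟩ := hφ
  have h0 : dNorm ℱ P p q ((f - g : D 𝕜 ℱ P hp hq) : ℕ → Ω → 𝕜) = 0 := by
    rw [← dNorm_zero (ℱ := ℱ) (P := P) (𝕜 := 𝕜) hp hq]
    refine dNorm_congr_ae fun n => ?_
    filter_upwards [h n] with ω hω
    simp [hω]
  have h1 := hC (f - g)
  rw [h0, mul_zero, nonpos_iff_eq_zero, enorm_eq_zero, map_sub, sub_eq_zero] at h1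
  exact h1

theorem condExpMartingale_mem_D [IsProbabilityMeasure P] (hreg : IsRegular ℱ P)
    (hp : 0 < p) (hp2 : p < 2) (hq : 0 < q) {f : Ω → 𝕜} (hf : MemLp f 2 P)
    (hf0 : P[f | ℱ 0] =ᵐ[P] 0) : condExpMartingale ℱ P f ∈ D 𝕜 ℱ P hp hq := by
  obtain ⟨K, hK⟩ := exists_dNorm_condExpMartingale_le (𝕜 := 𝕜) hreg hp hp2 hq
    (∫ ω, ‖f ω‖ ^ 2 ∂P).toNNReal
  exact ⟨martingale_condExp f ℱ P, hf0,
    (hK f hf (Real.le_coe_toNNReal _)).trans_lt ENNReal.coe_lt_top⟩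

/-- The subspace of `L₂` of the functions with vanishing conditional expectation given `m`. -/
def condExpKer (𝕜 : Type*) [RCLike 𝕜] (P : Measure Ω) [IsFiniteMeasure P] (m : MeasurableSpace Ω) :
    Submodule 𝕜 (Lp 𝕜 2 P) where
  carrier := {f | P[f | m] =ᵐ[P] 0}
  zero_mem' := by
    have h := condExp_congr_ae (m := m) (Lp.coeFn_zero 𝕜 2 P)
    rwa [condExp_zero] at h
  add_mem' := by
    intro f g (hf : P[f | m] =ᵐ[P] 0) (hg : P[g | m] =ᵐ[P] 0)
    have h := (condExp_congr_ae (m := m) (Lp.coeFn_add f g)).trans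
      (condExp_add ((Lp.memLp f).integrable one_le_two) ((Lp.memLp g).integrable one_le_two) m)
    refine h.trans ?_
    simpa using hf.add hg
  smul_mem' := by
    intro c f (hf : P[f | m] =ᵐ[P] 0)
    have h := (condExp_congr_ae (m := m) (Lp.coeFn_smul c f)).trans (condExp_smul c f m)
    refine h.trans ?_
    filter_upwards [hf] with ω hω
    simp [hω]

theorem exists_representedOn_two [IsProbabilityMeasure P] (hreg : IsRegular ℱ P)
    {hp : 0 < p} (hp2 : p < 2) {hq : 0 < q} {φ : D 𝕜 ℱ P hp hq →ₗ[𝕜] 𝕜}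
    (hφ : φ ∈ dualD 𝕜 ℱ P hp hq) :
    ∃ g : Ω → 𝕜, MemLp g 2 P ∧ RepresentedOn ℱ P φ 2 g := by
  have hmem : ∀ f : condExpKer 𝕜 P (ℱ 0), condExpMartingale ℱ P (f : Lp 𝕜 2 P) ∈ D 𝕜 ℱ P hp hq :=
    fun f => condExpMartingale_mem_D hreg hp hp2 hq (Lp.memLp _) f.2
  let ψ : condExpKer 𝕜 P (ℱ 0) →ₗ[𝕜] 𝕜 :=
    { toFun := fun f => φ ⟨_, hmem f⟩
      map_add' := by
        intro f g
        rw [← map_add]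
        refine apply_eq_of_ae_eq hφ fun n => ?_
        exact (condExp_congr_ae (Lp.coeFn_add (f : Lp 𝕜 2 P) g)).trans
          (condExp_add ((Lp.memLp _).integrable one_le_two)
            ((Lp.memLp _).integrable one_le_two) _)
      map_smul' := by
        intro c f
        rw [RingHom.id_apply, ← map_smul]
        refine apply_eq_of_ae_eq hφ fun n => ?_
        exact (condExp_congr_ae (Lp.coeFn_smul c (f : Lp 𝕜 2 P))).trans (condExp_smul c _ _) }
  obtain ⟨C, hC⟩ := id hφ
  obtain ⟨K, hK⟩ := exists_dNorm_condExpMartingale_le (𝕜 := 𝕜) hreg hp hp2 hq 1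
  -- Linearity of `ψ` reduces this to the unit sphere, so homogeneity of `dNorm` is not needed.
  have hbound : ∀ f, ‖ψ f‖ ≤ (C * K : ℝ≥0) / 1 * ‖f‖ := by
    refine LinearMap.bound_of_sphere_bound one_pos _ ψ fun f hf => ?_
    have hf1 : ‖(f : Lp 𝕜 2 P)‖ = 1 := by simpa using hf
    have hsq : ∫ ω, ‖(f : Lp 𝕜 2 P) ω‖ ^ 2 ∂P ≤ (1 : ℝ≥0) := by
      have h := @inner_self_eq_norm_sq_to_K 𝕜 (Lp 𝕜 2 P) _ _ _ (f : Lp 𝕜 2 P)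
      rw [L2.inner_def, hf1] at h
      simp only [inner_self_eq_norm_sq_to_K] at h
      have h' : ((∫ ω, ‖(f : Lp 𝕜 2 P) ω‖ ^ 2 ∂P : ℝ) : 𝕜) = ((1 : ℝ) : 𝕜) := by
        rw [← integral_ofReal]
        simpa using h
      simpa using (RCLike.ofReal_inj.1 h').le
    have h1 : ‖ψ f‖ₑ ≤ (C * K : ℝ≥0) := by
      rw [ENNReal.coe_mul]
      exact (hC _).trans (by gcongr; exact hK _ (Lp.memLp _) hsq)
    exact ENNReal.coe_le_coe.1 h1
  -- Extending by Hahn–Banach to all of `L₂` avoids checking that the kernel of `E_0` is closed.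
  obtain ⟨Ψ, hΨ, -⟩ := exists_extension_norm_eq _ (ψ.mkContinuous _ hbound)
  set g₀ : Lp 𝕜 2 P := (InnerProductSpace.toDual 𝕜 _).symm Ψ with hg₀
  -- The inner product is conjugate-linear in its first slot, while the pairing `E(fg)` is bilinear;
  -- hence the conjugate.
  refine ⟨fun ω => star (g₀ ω), (Lp.memLp g₀).star, fun f hf hf0 => ?_⟩
  refine ⟨condExpMartingale_mem_D hreg hp hp2 hq hf hf0, ?_⟩
  have hker : hf.toLp f ∈ condExpKer 𝕜 P (ℱ 0) := (condExp_congr_ae hf.coeFn_toLp).trans hf0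
  calc φ ⟨condExpMartingale ℱ P f, _⟩ = ψ ⟨hf.toLp f, hker⟩ :=
        apply_eq_of_ae_eq hφ fun n => (condExp_congr_ae hf.coeFn_toLp).symm
    _ = Ψ (hf.toLp f) := (hΨ ⟨hf.toLp f, hker⟩).symm
    _ = inner 𝕜 g₀ (hf.toLp f) := by rw [hg₀, InnerProductSpace.toDual_symm_apply]
    _ = ∫ ω, f ω * star (g₀ ω) ∂P := by
        rw [L2.inner_def]
        refine integral_congr_ae ?_
        filter_upwards [hf.coeFn_toLp] with ω hω
        rw [hω, RCLike.inner_apply]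
        rfl

end Representation

end MartingaleLorentz

theorem proposition5p5 {𝕜 : Type*} [RCLike 𝕜] {Ω : Type*} {m0 : MeasurableSpace Ω}
    (P : Measure Ω) [IsProbabilityMeasure P] (ℱ : Filtration ℕ m0)
    (hgen : MartingaleLorentz.Generates ℱ P) (hreg : MartingaleLorentz.IsRegular ℱ P)
    {p q : ℝ} (hp : 0 < p) (hp1 : p ≤ 1) (hq : 0 < q) :
    MartingaleLorentz.dualDOne 𝕜 ℱ P hp hq
        = (MartingaleLorentz.dualD 𝕜 ℱ P hp hq : Set (MartingaleLorentz.D 𝕜 ℱ P hp hq →ₗ[𝕜] 𝕜)) ∧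
      ∀ φ ∈ MartingaleLorentz.dualD 𝕜 ℱ P hp hq, ∃ g : Ω → 𝕜, MemLp g 2 P ∧
        MartingaleLorentz.RepresentedOn ℱ P φ 2 g := by
  have hp2 : p < 2 := hp1.trans_lt one_lt_two
  refine ⟨Set.Subset.antisymm (fun φ hφ => hφ.1) fun φ hφ => ?_,
    fun φ hφ => MartingaleLorentz.exists_representedOn_two hreg hp2 hφ⟩
  obtain ⟨g, hg, hrep⟩ := MartingaleLorentz.exists_representedOn_two hreg hp2 hφ
  exact ⟨hφ, g, hg.mono_exponent one_le_two, fun f hf => hrep f (hf.mono_exponent le_top)⟩
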